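/- Let $K$ be a number field, let $\mathcal{O}$ be its ring of integers, and let $\Sigma$ be the set of embeddings $\sigma : K \to \mathbb{C}$. A Hermitian vector bundle $(E,h)$ on $\operatorname{Spec}\mathcal{O}$ consists of a finitely generated projective $\mathcal{O}$-module $E$ and a collection $h=(h_\sigma)_{\sigma\in\Sigma}$ of positive definite Hermitian forms $h_\sigma$ on $E\otimes_{\sigma}\mathbb{C}$ such that $h_{\bar\sigma}(x,y)=h_\sigma(y,x)$ for all $x,y\in E$ and $\sigma\in\Sigma$. Put $\|x\|_\sigma=h_\sigma(x,x)^{1/2}$. Let $\mathrm{Bun}(\overline{\operatorname{Spec}\mathcal{O}})$ be the category of Hermitian vector bundles, whose morphisms $f:(E,h)\to(E',h')$ are the $\mathcal{O}$-linear maps $f:E\to E'$ such that $\|f(x)\|_\sigma\le\|x\|_\sigma$ for all $\sigma\in\Sigma$ and $x\in E$. In a category with a zero object, a pair of composable morphisms $X\xrightarrow{f}Y\xrightarrow{g}Z$ is called exact if $f$ is a kernel of $g$ and $g$ is a cokernel of $f$; in this case $f$ is called a strict monomorphism and $g$ a strict epimorphism. A category is called parabelian if it has a zero object, every morphism has a kernel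 and a cokernel, every strict epimorphism $g:Y'\to Y$ has, along every strict monomorphism $X\to Y$, a pullback $X'\to X$ that is a strict epimorphism, and every strict monomorphism $f':X'\to Y'$ has, along every strict epimorphism $X'\to X$, a pushout $X\to Y$ that is a strict monomorphism. **Theorem.** The category $\mathrm{Bun}(\overline{\operatorname{Spec}\mathcal{O}})$ of Hermitian vector bundles on $\operatorname{Spec}\mathcal{O}$ is parabelian. -/

import Mathlib

open CategoryTheory CategoryTheory.Limits
open scoped NumberField TensorProduct

universe v u

/-! ### Parabelian categories -/

section Parabelian

variable {C : Type u} [Category.{v} C]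

/-- A class of morphisms `A` is closed under pullbacks along a class `B` if, for all
`g : Y' ⟶ Y` in `A` and `f : X ⟶ Y` in `B`, there is a cartesian square over `g` and `f`
in which the pullback `g' : X' ⟶ X` of `g` along `f` lies in `A`. -/
def ClosedUnderPullbacksAlong (A B : MorphismProperty C) : Prop :=
  ∀ ⦃X Y Y' : C⦄ (g : Y' ⟶ Y) (f : X ⟶ Y), A g → B f →
    ∃ (X' : C) (f' : X' ⟶ Y') (g' : X' ⟶ X), IsPullback f' g' g f ∧ A g'

/-- A class of morphisms `A` is closed under pushouts along a class `B` if, for all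
`f' : X' ⟶ Y'` in `A` and `g' : X' ⟶ X` in `B`, there is a cocartesian square under `f'` and
`g'` in which the pushout `f : X ⟶ Y` of `f'` along `g'` lies in `A`. -/
def ClosedUnderPushoutsAlong (A B : MorphismProperty C) : Prop :=
  ∀ ⦃X' Y' X : C⦄ (f' : X' ⟶ Y') (g' : X' ⟶ X), A f' → B g' →
    ∃ (Y : C) (g : Y' ⟶ Y) (f : X ⟶ Y), IsPushout f' g' g f ∧ A f

variable [HasZeroMorphisms C]

/-- A composable pair `X ⟶ Y ⟶ Z` is exact if `f` is a kernel of `g` and `g` is a cokernel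
of `f`. -/
def IsExactPair {X Y Z : C} (f : X ⟶ Y) (g : Y ⟶ Z) : Prop :=
  ∃ w : f ≫ g = 0,
    Nonempty (IsLimit (KernelFork.ofι f w)) ∧ Nonempty (IsColimit (CokernelCofork.ofπ g w))

variable (C) in
/-- Strict monomorphisms: the first members of exact pairs. -/
def strictMono : MorphismProperty C :=
  fun _ Y f => ∃ (Z : C) (g : Y ⟶ Z), IsExactPair f g

variable (C) in
/-- Strict epimorphisms: the second members of exact pairs. -/
def strictEpi : MorphismProperty C :=
  fun Y _ g => ∃ (X : C) (f : X ⟶ Y), IsExactPair f g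

variable (C) in
/-- A parabelian category: a pointed category with kernels and cokernels in which strict
epimorphisms are closed under pullbacks along strict monomorphisms and strict monomorphisms
are closed under pushouts along strict epimorphisms. (The structure `HasZeroMorphisms C` is
unique; in the presence of a zero object its zero morphisms are those factoring through it.) -/
structure IsParabelian : Prop where
  hasZeroObject : HasZeroObject C
  hasKernels : HasKernels C
  hasCokernels : HasCokernels C
  strictEpi_pullback : ClosedUnderPullbacksAlong (strictEpi C) (strictMono C)
  strictMono_pushout : ClosedUnderPushoutsAlong (strictMono C) (strictEpi C)

end Parabelian

/-! ### Hermitian vector bundles over the ring of integers of a number field -/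

noncomputable section HermitianBundles

section Fiber

variable {K : Type u} [Field K] (σ : K →+* ℂ) (E : Type v) [AddCommGroup E] [Module (𝓞 K) E]

/-- `ℂ` as an algebra over the ring of integers `𝓞 K` through `σ : K → ℂ`. -/
@[reducible] def complexAlgebra : Algebra (𝓞 K) ℂ :=
  (σ.comp (algebraMap (𝓞 K) K)).toAlgebra

/-- The complex vector space `E ⊗_σ ℂ`. -/
abbrev ComplexFiber : Type v :=
  letI := complexAlgebra σ
  ℂ ⊗[𝓞 K] E

variable {E} in
/-- The canonical additive map `E → E ⊗_σ ℂ`, `x ↦ x ⊗ 1`. -/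
def toFiber : E →+ ComplexFiber σ E :=
  letI := complexAlgebra σ
  (TensorProduct.mk (𝓞 K) ℂ E 1).toAddMonoidHom

end Fiber

/-- A Hermitian vector bundle `(E, h)` on `Spec 𝓞 K`: a finitely generated projective
`𝓞 K`-module `E` with a positive definite Hermitian form `h_σ` on `E ⊗_σ ℂ` for every embedding
`σ : K → ℂ`, compatible with complex conjugation. -/
structure HermitianBundle (K : Type u) [Field K] where
  /-- the underlying module -/
  carrier : Type v
  [addCommGroup : AddCommGroup carrier]
  [module : Module (𝓞 K) carrier]
  [finite : Module.Finite (𝓞 K) carrier]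
  [projective : Module.Projective (𝓞 K) carrier]
  /-- the Hermitian forms -/
  form : ∀ σ : K →+* ℂ, InnerProductSpace.Core ℂ (ComplexFiber σ carrier)
  form_conjugate : ∀ (σ : K →+* ℂ) (x y : carrier),
    (form (NumberField.ComplexEmbedding.conjugate σ)).inner (toFiber _ x) (toFiber _ y) =
      (form σ).inner (toFiber σ y) (toFiber σ x)

namespace HermitianBundle

attribute [instance] addCommGroup module finite projective

variable {K : Type u} [Field K]

/-- The norm `‖x‖_σ = h_σ(x, x)^{1/2}` of `x ∈ E`. -/
def normAt (E : HermitianBundle.{v} K) (σ : K →+* ℂ) (x : E.carrier) : ℝ :=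
  √((E.form σ).inner (toFiber σ x) (toFiber σ x)).re

/-- A morphism of Hermitian vector bundles: an `𝓞 K`-linear map `f : E → E'` with
`‖f x‖_σ ≤ ‖x‖_σ` for all `σ` and all `x ∈ E`. -/
@[ext]
structure Hom (E E' : HermitianBundle.{v} K) where
  /-- the underlying linear map -/
  toLinearMap : E.carrier →ₗ[𝓞 K] E'.carrier
  normAt_le : ∀ (σ : K →+* ℂ) (x : E.carrier), E'.normAt σ (toLinearMap x) ≤ E.normAt σ x

instance : Category.{v} (HermitianBundle.{v} K) where
  Hom := Hom
  id E := ⟨LinearMap.id, fun _ _ => le_rfl⟩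
  comp f g := ⟨g.toLinearMap ∘ₗ f.toLinearMap,
    fun σ x => (g.normAt_le σ (f.toLinearMap x)).trans (f.normAt_le σ x)⟩

theorem normAt_zero (E : HermitianBundle.{v} K) (σ : K →+* ℂ) : E.normAt σ 0 = 0 := by
  have h := (E.form σ).smul_left 0 0 0
  rw [zero_smul, map_zero, zero_mul] at h
  rw [normAt, map_zero, h, Complex.zero_re, Real.sqrt_zero]

/-- The zero morphisms are the zero linear maps. -/
instance : HasZeroMorphisms (HermitianBundle.{v} K) where
  zero E E' := ⟨⟨0, fun σ x => by
    rw [LinearMap.zero_apply, normAt_zero]; exact Real.sqrt_nonneg _⟩⟩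
  comp_zero _ _ := Hom.ext (LinearMap.zero_comp _)
  zero_comp _ _ _ f := Hom.ext (LinearMap.comp_zero f.toLinearMap)

end HermitianBundle

end HermitianBundles

/-! ### Inner product cores -/

section Core

variable {V W : Type*} [AddCommGroup V] [Module ℂ V] [AddCommGroup W] [Module ℂ W]

/-! Kernels and cokernels are those of modules, corrected by torsion and equipped with metrics. A
finitely generated torsion-free module over the Dedekind domain `𝓞 K` is projective, so the module
kernel with the restricted forms is a bundle, and so is the module cokernel modulo torsion. The
latter carries the quotient norms: on each complex fiber they are Hermitian because the quotient is
identified with the orthogonal complement of the kernel, and they are compatible with conjugation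
because orthogonal lifts are unique.

Hence strict monomorphisms are the isometric injections with saturated image (`strictMono_iff`), and
strict epimorphisms are the surjections for which each vector of a complex fiber has a lift of no
larger norm (`strictEpi_iff`). Both closure properties come down to moving such a lift around a
square.

Lifts live in the fibers, whereas morphisms are contracting only on the modules. The bridge is
`nonneg_of_nonneg_toFiber`: semipositivity passes from a module to its fibers, by density of `σ(K)`
in `ℂ`, or in `ℝ` together with symmetry of the form. -/

/-- The pullback of an inner product along an injective linear map. -/
@[reducible] def InnerProductSpace.Core.comap (c : InnerProductSpace.Core ℂ W) (s : V →ₗ[ℂ] W)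
    (hs : Function.Injective s) : InnerProductSpace.Core ℂ V where
  inner x y := c.inner (s x) (s y)
  conj_inner_symm x y := c.conj_inner_symm (s x) (s y)
  re_inner_nonneg x := c.re_inner_nonneg (s x)
  add_left x y z := by rw [map_add]; exact c.add_left _ _ _
  smul_left x y _ := by rw [map_smul]; exact c.smul_left _ _ _
  definite x hx := hs (by rw [map_zero]; exact c.definite _ hx)

/-- The sesquilinear form underlying an inner product. -/
def InnerProductSpace.Core.sesqForm (c : InnerProductSpace.Core ℂ V) : V →ₗ⋆[ℂ] V →ₗ[ℂ] ℂ :=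
  LinearMap.mk₂'ₛₗ _ _ c.inner c.add_left
    (fun r x y => c.smul_left x y r)
    (fun x y z => InnerProductSpace.Core.inner_add_right (c := c.toCore) x y z)
    (fun _ x y => InnerProductSpace.Core.inner_smul_right (c := c.toCore) x y)

theorem InnerProductSpace.Core.sesqForm_apply (c : InnerProductSpace.Core ℂ V) (x y : V) :
    c.sesqForm x y = c.inner x y := rfl

/-- A surjection of finite-dimensional inner product spaces has a section with image orthogonal
to the kernel. -/
theorem InnerProductSpace.Core.exists_orthogonal_section [FiniteDimensional ℂ V]
    (c : InnerProductSpace.Core ℂ V) (p : V →ₗ[ℂ] W) (hp : Function.Surjective p) :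
    ∃ s : W →ₗ[ℂ] V, (∀ w, p (s w) = w) ∧ ∀ w v, p v = 0 → c.inner v (s w) = 0 := by
  let : NormedAddCommGroup V := c.toNormedAddCommGroup
  let : InnerProductSpace ℂ V := InnerProductSpace.ofCore c.toCore
  obtain ⟨t, ht⟩ := p.exists_rightInverse_of_surjective (LinearMap.range_eq_top.2 hp)
  have ht' (w : W) : p (t w) = w := LinearMap.congr_fun ht w
  -- Projecting an arbitrary section onto the complement of `ker p` changes it only by elements of
  -- `ker p`.
  refine ⟨(LinearMap.ker p)ᗮ.starProjection.toLinearMap ∘ₗ t, fun w => ?_, fun w v hv => ?_⟩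
  · have h : t w - (LinearMap.ker p)ᗮ.starProjection (t w) ∈ LinearMap.ker p := by
      have := Submodule.sub_starProjection_mem_orthogonal (K := (LinearMap.ker p)ᗮ) (t w)
      rwa [Submodule.orthogonal_orthogonal] at this
    rw [LinearMap.mem_ker, map_sub, ht', sub_eq_zero] at h
    exact h.symm
  · have h : (LinearMap.ker p)ᗮ.starProjection (t w) ∈ (LinearMap.ker p)ᗮ :=
      Submodule.starProjection_apply_mem _ _
    exact (Submodule.mem_orthogonal _ _).1 h v (LinearMap.mem_ker.2 hv)

end Core

/-! ### Complex fibers -/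

noncomputable section Fibers

open NumberField

variable {K : Type u} [Field K] (σ : K →+* ℂ)
variable {E F G : Type v} [AddCommGroup E] [Module (𝓞 K) E] [AddCommGroup F] [Module (𝓞 K) F]
  [AddCommGroup G] [Module (𝓞 K) G]

theorem toFiber_smul (r : 𝓞 K) (x : E) : toFiber σ (r • x) = σ r • toFiber σ x := by
  let := complexAlgebra σ
  change (1 : ℂ) ⊗ₜ[𝓞 K] (r • x) = σ r • ((1 : ℂ) ⊗ₜ[𝓞 K] x)
  rw [← TensorProduct.smul_tmul, TensorProduct.smul_tmul']
  rfl

theorem smul_toFiber_eq_tmul (z : ℂ) (x : E) :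
    z • toFiber σ x = (letI := complexAlgebra σ; z ⊗ₜ[𝓞 K] x) := by
  let := complexAlgebra σ
  change z • ((1 : ℂ) ⊗ₜ[𝓞 K] x) = _
  rw [TensorProduct.smul_tmul', smul_eq_mul, mul_one]

theorem ComplexFiber.induction {P : ComplexFiber σ E → Prop}
    (smul : ∀ (z : ℂ) (x : E), P (z • toFiber σ x)) (add : ∀ u v, P u → P v → P (u + v))
    (u : ComplexFiber σ E) : P u := by
  let := complexAlgebra σ
  induction u using TensorProduct.induction_on with
  | zero => simpa using smul 0 0
  | tmul z x => rw [← smul_toFiber_eq_tmul]; exact smul z x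
  | add u v hu hv => exact add u v hu hv

theorem ComplexFiber.exists_sum (u : ComplexFiber σ E) :
    ∃ (n : ℕ) (c : Fin n → ℂ) (x : Fin n → E), u = ∑ i, c i • toFiber σ (x i) := by
  induction u using ComplexFiber.induction with
  | smul z x => exact ⟨1, fun _ => z, fun _ => x, by simp⟩
  | add u v hu hv =>
    obtain ⟨m, c, x, rfl⟩ := hu
    obtain ⟨n, d, y, rfl⟩ := hv
    exact ⟨m + n, Fin.append c d, Fin.append x y, by simp [Fin.sum_univ_add]⟩

instance [Module.Finite (𝓞 K) E] : FiniteDimensional ℂ (ComplexFiber σ E) := by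
  let := complexAlgebra σ
  exact Module.Finite.base_change (𝓞 K) ℂ E

/-- The `ℂ`-linear map on complex fibers induced by a linear map. -/
def fiberMap (f : E →ₗ[𝓞 K] F) : ComplexFiber σ E →ₗ[ℂ] ComplexFiber σ F :=
  letI := complexAlgebra σ
  f.baseChange ℂ

@[simp] theorem fiberMap_toFiber (f : E →ₗ[𝓞 K] F) (x : E) :
    fiberMap σ f (toFiber σ x) = toFiber σ (f x) := rfl

theorem fiberMap_comp (g : F →ₗ[𝓞 K] G) (f : E →ₗ[𝓞 K] F) (u : ComplexFiber σ E) :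
    fiberMap σ (g ∘ₗ f) u = fiberMap σ g (fiberMap σ f u) := by
  let := complexAlgebra σ
  exact LinearMap.congr_fun (LinearMap.baseChange_comp (A := ℂ) f g) u

@[simp] theorem fiberMap_id (u : ComplexFiber σ E) :
    fiberMap σ (LinearMap.id : E →ₗ[𝓞 K] E) u = u := by
  let := complexAlgebra σ
  exact LinearMap.congr_fun LinearMap.baseChange_id u

@[simp] theorem fiberMap_zero (u : ComplexFiber σ E) :
    fiberMap σ (0 : E →ₗ[𝓞 K] F) u = 0 := by
  let := complexAlgebra σ
  exact LinearMap.congr_fun LinearMap.baseChange_zero u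

theorem fiberMap_surjective {f : E →ₗ[𝓞 K] F} (hf : Function.Surjective f) :
    Function.Surjective (fiberMap σ f) := by
  let := complexAlgebra σ
  exact LinearMap.lTensor_surjective ℂ hf

/-! ### Conjugation between the fibers at conjugate embeddings -/

section Conj

variable (E) in
/-- The biadditive map `(z, x) ↦ conj z ⊗ x`. -/
def conjSMulToFiber : ℂ →+ E →+ ComplexFiber σ E :=
  AddMonoidHom.mk' (fun z => AddMonoidHom.mk' (fun x => (starRingEnd ℂ z) • toFiber σ x)
    (fun x y => by rw [map_add, smul_add])) (fun z w => by ext x; simp [add_smul])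

theorem conjSMulToFiber_balanced (r : 𝓞 K) (z : ℂ) (x : E) :
    conjSMulToFiber σ E (starRingEnd ℂ (σ r) * z) x = conjSMulToFiber σ E z (r • x) := by
  change (starRingEnd ℂ) (starRingEnd ℂ (σ r) * z) • toFiber σ x =
    (starRingEnd ℂ z) • toFiber σ (r • x)
  rw [toFiber_smul, smul_smul, map_mul, Complex.conj_conj, mul_comm]

variable (E) in
/-- The conjugate-linear map `z ⊗ x ↦ conj z ⊗ x` between the fibers at conjugate embeddings. -/
def fiberConj : ComplexFiber (ComplexEmbedding.conjugate σ) E →+ ComplexFiber σ E :=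
  letI := complexAlgebra (ComplexEmbedding.conjugate σ)
  TensorProduct.liftAddHom (conjSMulToFiber σ E)
    (conjSMulToFiber_balanced σ)

theorem fiberConj_smul_toFiber (z : ℂ) (x : E) :
    fiberConj σ E (z • toFiber _ x) = starRingEnd ℂ z • toFiber σ x := by
  rw [smul_toFiber_eq_tmul]; rfl

@[simp] theorem fiberConj_toFiber (x : E) :
    fiberConj σ E (toFiber _ x) = toFiber σ x := by
  simpa using fiberConj_smul_toFiber σ 1 x

theorem fiberMap_fiberConj (f : E →ₗ[𝓞 K] F) (u) :
    fiberMap σ f (fiberConj σ E u) = fiberConj σ F (fiberMap _ f u) := by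
  induction u using ComplexFiber.induction with
  | smul z x => simp [fiberConj_smul_toFiber]
  | add u v hu hv => simp [hu, hv]

theorem fiberConj_surjective : Function.Surjective (fiberConj σ E) := fun u => by
  induction u using ComplexFiber.induction with
  | smul z x => exact ⟨starRingEnd ℂ z • toFiber _ x, by simp [fiberConj_smul_toFiber]⟩
  | add u v hu hv =>
    obtain ⟨u, rfl⟩ := hu
    obtain ⟨v, rfl⟩ := hv
    exact ⟨u + v, map_add _ _ _⟩

end Conj

/-! ### Flatness and projectivity -/

variable [NumberField K]

/-- As `σ` is injective, `ℂ` is torsion-free over a Dedekind domain, hence flat. -/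
theorem complexAlgebra_flat : letI := complexAlgebra σ; Module.Flat (𝓞 K) ℂ := by
  let := complexAlgebra σ
  have : Module.IsTorsionFree (𝓞 K) ℂ := .of_smul_eq_zero fun r z h => by
    change σ r * z = 0 at h
    simpa using h
  infer_instance

theorem fiberMap_injective {f : E →ₗ[𝓞 K] F} (hf : Function.Injective f) :
    Function.Injective (fiberMap σ f) := by
  let := complexAlgebra σ
  have := complexAlgebra_flat σ
  exact Module.Flat.lTensor_preserves_injective_linearMap (M := ℂ) f hf

theorem fiberMap_exact {f : E →ₗ[𝓞 K] F} {g : F →ₗ[𝓞 K] G} (h : Function.Exact f g) :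
    Function.Exact (fiberMap σ f) (fiberMap σ g) := by
  let := complexAlgebra σ
  have := complexAlgebra_flat σ
  exact Module.Flat.lTensor_exact ℂ h

/-- If `ker g` is contained in the saturation of `im f`, then `ker g_σ ⊆ im f_σ`. -/
theorem exists_fiberMap_eq {f : E →ₗ[𝓞 K] F} {g : F →ₗ[𝓞 K] G}
    (h : ∀ y, g y = 0 → ∃ a : 𝓞 K, a ≠ 0 ∧ ∃ x, f x = a • y) (v : ComplexFiber σ F)
    (hv : fiberMap σ g v = 0) : ∃ u, fiberMap σ f u = v := by
  obtain ⟨w, rfl⟩ :=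
    (fiberMap_exact σ (LinearMap.exact_subtype_ker_map g) v).1 hv
  clear hv
  induction w using ComplexFiber.induction with
  | smul z y =>
    obtain ⟨a, ha, x, hx⟩ := h y y.2
    have ha' : σ a ≠ 0 := by simpa using ha
    refine ⟨(z / σ a) • toFiber σ x, ?_⟩
    rw [map_smul, fiberMap_toFiber, hx, toFiber_smul, smul_smul, div_mul_cancel₀ _ ha']
    simp
  | add u v hu hv =>
    obtain ⟨u', hu⟩ := hu
    obtain ⟨v', hv⟩ := hv
    exact ⟨u' + v', by rw [map_add, map_add, hu, hv]⟩

theorem Module.Projective.of_finite_of_isTorsionFree {R M : Type*} [CommRing R]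
    [IsDedekindDomain R] [AddCommGroup M] [Module R M] [Module.Finite R M]
    [Module.IsTorsionFree R M] : Module.Projective R M := by
  have := Module.finitePresentation_of_finite R M
  exact Module.Flat.projective_of_finitePresentation

end Fibers

/-! ### Norms on complex fibers -/

noncomputable section Bundles

namespace HermitianBundle

open NumberField

variable {K : Type u} [Field K]

/-- The squared norm on the complex fiber of a Hermitian bundle. -/
def normSqAt (E : HermitianBundle.{v} K) (σ : K →+* ℂ) (u : ComplexFiber σ E.carrier) : ℝ :=
  ((E.form σ).inner u u).re

theorem normSqAt_nonneg (E : HermitianBundle.{v} K) (σ : K →+* ℂ) (u) : 0 ≤ E.normSqAt σ u :=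
  (E.form σ).re_inner_nonneg u

theorem normAt_le_normAt_iff {E F : HermitianBundle.{v} K} {σ : K →+* ℂ} {x : E.carrier}
    {y : F.carrier} : E.normAt σ x ≤ F.normAt σ y ↔
      E.normSqAt σ (toFiber σ x) ≤ F.normSqAt σ (toFiber σ y) :=
  Real.sqrt_le_sqrt_iff (normSqAt_nonneg _ _ _)

/-- Both sides are linear in `u` and conjugate-linear in `v`, so the identity `form_conjugate` on
the module suffices. -/
theorem inner_fiberConj (E : HermitianBundle.{v} K) (σ : K →+* ℂ) (u v) :
    (E.form σ).inner (fiberConj σ _ u) (fiberConj σ _ v) =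
      (E.form (ComplexEmbedding.conjugate σ)).inner v u := by
  simp only [← InnerProductSpace.Core.sesqForm_apply]
  induction u using ComplexFiber.induction with
  | smul z x =>
    induction v using ComplexFiber.induction with
    | smul w y =>
      simp only [fiberConj_smul_toFiber, map_smulₛₗ, LinearMap.smul_apply, smul_eq_mul, RingHom.id_apply,
        InnerProductSpace.Core.sesqForm_apply, form_conjugate, Complex.conj_conj]
      ring
    | add v w hv hw => simp only [map_add, LinearMap.add_apply, hv, hw]
  | add u v hu hv => simp only [map_add, LinearMap.add_apply, hu, hv]

end HermitianBundle

/-! ### Semipositivity on the fibers from semipositivity on the bundle -/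

section Density

variable {K : Type u} [Field K] (σ : K →+* ℂ)

/-- The closure is a closed subfield of `ℂ`, so it is `ℝ` or `ℂ`. -/
theorem complexEmbedding_closure_range :
    (closure (Set.range σ) = Set.univ) ∨
      (closure (Set.range σ) = Set.range ((↑) : ℝ → ℂ) ∧
        NumberField.ComplexEmbedding.conjugate σ = σ) := by
  have hc : IsClosed (σ.fieldRange.topologicalClosure : Set ℂ) :=
    Subfield.isClosed_topologicalClosure _
  have he : (σ.fieldRange.topologicalClosure : Set ℂ) = closure (Set.range σ) := by
    rw [← RingHom.coe_fieldRange]; rfl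
  rcases Complex.subfield_eq_of_closed hc with h | h
  · right
    have h' : closure (Set.range σ) = Set.range ((↑) : ℝ → ℂ) := by
      rw [← he, h]; rfl
    refine ⟨h', RingHom.ext fun k => ?_⟩
    obtain ⟨r, hr⟩ : σ k ∈ Set.range ((↑) : ℝ → ℂ) := h' ▸ subset_closure ⟨k, rfl⟩
    rw [NumberField.ComplexEmbedding.conjugate_coe_eq, ← hr, Complex.conj_ofReal]
  · left
    rw [← he, h]; rfl

variable [NumberField K]
variable {E : Type v} [AddCommGroup E] [Module (𝓞 K) E]

/-- The inequality is a closed condition on the coefficients. If these lie in `σ(K)`, a common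
denominator makes the combination a scalar multiple of an element of `E`. -/
theorem nonneg_of_mem_closure_range
    (H : ComplexFiber σ E →ₗ⋆[ℂ] ComplexFiber σ E →ₗ[ℂ] ℂ)
    (hH : ∀ x : E, 0 ≤ (H (toFiber σ x) (toFiber σ x)).re) {ι : Type*} [Fintype ι]
    (x : ι → E) (c : ι → ℂ) (hc : ∀ i, c i ∈ closure (Set.range σ)) :
    0 ≤ (H (∑ i, c i • toFiber σ (x i)) (∑ i, c i • toFiber σ (x i))).re := by
  set S : Set (ι → ℂ) :=
    {c | 0 ≤ (H (∑ i, c i • toFiber σ (x i)) (∑ i, c i • toFiber σ (x i))).re} with hS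
  have hcl : IsClosed S := by
    refine isClosed_le continuous_const (Complex.continuous_re.comp ?_)
    simp only [map_sum, LinearMap.sum_apply, map_smulₛₗ, LinearMap.smul_apply,
      RingHom.id_apply, smul_eq_mul]
    fun_prop
  have hsub : Set.univ.pi (fun _ : ι => Set.range σ) ⊆ S := by
    intro c hc
    choose k hk using fun i => hc i (Set.mem_univ i)
    obtain ⟨b, hb⟩ := IsLocalization.exist_integer_multiples (nonZeroDivisors (𝓞 K))
      Finset.univ k
    choose r hr using fun i => hb i (Finset.mem_univ i)
    have hb0 : σ (b : 𝓞 K) ≠ 0 := by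
      simp
    have hsum : ∑ i, c i • toFiber σ (x i) =
        (σ (b : 𝓞 K))⁻¹ • toFiber σ (∑ i, r i • x i) := by
      rw [map_sum, Finset.smul_sum]
      refine Finset.sum_congr rfl fun i _ => ?_
      have h : σ (r i) = σ (b : 𝓞 K) * c i := by
        rw [← hk i, ← map_mul]
        congr 1
        rw [← Algebra.smul_def]
        exact hr i
      rw [toFiber_smul, smul_smul, h, inv_mul_cancel_left₀ hb0]
    rw [hS, Set.mem_ofPred_eq, hsum]
    simp only [map_smulₛₗ, LinearMap.smul_apply, smul_eq_mul, RingHom.id_apply]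
    rw [← mul_assoc, mul_comm (_⁻¹), ← Complex.normSq_eq_conj_mul_self, Complex.re_ofReal_mul]
    exact mul_nonneg (Complex.normSq_nonneg _) (hH _)
  have : c ∈ closure (Set.univ.pi (fun _ : ι => Set.range σ)) := by
    rw [closure_pi_set]
    exact fun i _ => hc i
  exact closure_minimal hsub hcl this

/-- If `σ(K)` is dense only in `ℝ`, write `u = a + i b` with `a`, `b` real combinations; symmetry of
`H` cancels the cross terms, leaving `H a a + H b b`. -/
theorem nonneg_of_nonneg_toFiber
    (H : ComplexFiber σ E →ₗ⋆[ℂ] ComplexFiber σ E →ₗ[ℂ] ℂ)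
    (hsymm : NumberField.ComplexEmbedding.conjugate σ = σ →
      ∀ x y : E, H (toFiber σ x) (toFiber σ y) = H (toFiber σ y) (toFiber σ x))
    (hH : ∀ x : E, 0 ≤ (H (toFiber σ x) (toFiber σ x)).re) (u : ComplexFiber σ E) :
    0 ≤ (H u u).re := by
  obtain ⟨n, c, x, rfl⟩ := ComplexFiber.exists_sum σ u
  rcases complexEmbedding_closure_range σ with h | ⟨h, hσ⟩
  · exact nonneg_of_mem_closure_range σ H hH x c fun i => h ▸ Set.mem_univ _
  · have hpos (d : Fin n → ℝ) := nonneg_of_mem_closure_range σ H hH x (fun i => (d i : ℂ))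
      fun i => h ▸ ⟨d i, rfl⟩
    have hre := hpos fun i => (c i).re
    have him := hpos fun i => (c i).im
    have hc : ∑ i, c i • toFiber σ (x i) = ∑ i, ((c i).re : ℂ) • toFiber σ (x i) +
        Complex.I • ∑ i, ((c i).im : ℂ) • toFiber σ (x i) := by
      rw [Finset.smul_sum, ← Finset.sum_add_distrib]
      refine Finset.sum_congr rfl fun i _ => ?_
      rw [smul_smul, ← add_smul, mul_comm, Complex.re_add_im]
    have hab : H (∑ i, ((c i).re : ℂ) • toFiber σ (x i)) (∑ i, ((c i).im : ℂ) • toFiber σ (x i)) =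
        H (∑ i, ((c i).im : ℂ) • toFiber σ (x i)) (∑ i, ((c i).re : ℂ) • toFiber σ (x i)) := by
      simp only [map_sum, LinearMap.sum_apply, map_smulₛₗ, LinearMap.smul_apply,
        RingHom.id_apply, smul_eq_mul, Complex.conj_ofReal, Finset.mul_sum]
      rw [Finset.sum_comm]
      refine Finset.sum_congr rfl fun i _ => Finset.sum_congr rfl fun j _ => ?_
      rw [hsymm hσ]
      ring
    rw [hc]
    generalize ∑ i, ((c i).re : ℂ) • toFiber σ (x i) = a at *
    generalize ∑ i, ((c i).im : ℂ) • toFiber σ (x i) = b at *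
    have : H (a + Complex.I • b) (a + Complex.I • b) = H a a + H b b := by
      simp only [map_add, LinearMap.add_apply, map_smulₛₗ, LinearMap.smul_apply,
        RingHom.id_apply, smul_eq_mul, Complex.conj_I, hab]
      linear_combination (-(H b b)) * Complex.I_sq
    rw [this, Complex.add_re]
    exact add_nonneg hre him

end Density

namespace HermitianBundle

variable {K : Type u} [Field K]

theorem inner_toFiber_comm (E : HermitianBundle.{v} K) {σ : K →+* ℂ}
    (hσ : NumberField.ComplexEmbedding.conjugate σ = σ) (x y : E.carrier) :
    (E.form σ).inner (toFiber σ x) (toFiber σ y) =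
      (E.form σ).inner (toFiber σ y) (toFiber σ x) := by
  -- The fiber type depends on the embedding, so the equality is used by substitution for a variable
  -- `τ`.
  have h (τ : K →+* ℂ) (hτ : τ = σ) : (E.form τ).inner (toFiber τ x) (toFiber τ y) =
      (E.form σ).inner (toFiber σ x) (toFiber σ y) := by subst hτ; rfl
  rw [← h _ hσ, E.form_conjugate]

/-- Apply semipositivity to the difference of the two pulled-back forms. Taking `g` or `f` to be the
identity gives upper or lower norm bounds for a single map. -/
theorem normSqAt_fiberMap_le [NumberField K] {M : Type v} [AddCommGroup M] [Module (𝓞 K) M]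
    {E F : HermitianBundle.{v} K} (f : M →ₗ[𝓞 K] E.carrier) (g : M →ₗ[𝓞 K] F.carrier)
    (σ : K →+* ℂ) (h : ∀ x, E.normAt σ (f x) ≤ F.normAt σ (g x)) (u : ComplexFiber σ M) :
    E.normSqAt σ (fiberMap σ f u) ≤ F.normSqAt σ (fiberMap σ g u) := by
  let H : ComplexFiber σ M →ₗ⋆[ℂ] ComplexFiber σ M →ₗ[ℂ] ℂ :=
    ((F.form σ).sesqForm.comp (fiberMap σ g)).compl₂ (fiberMap σ g) -
      ((E.form σ).sesqForm.comp (fiberMap σ f)).compl₂ (fiberMap σ f)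
  have hH (u) : (H u u).re =
      F.normSqAt σ (fiberMap σ g u) - E.normSqAt σ (fiberMap σ f u) := rfl
  rw [← sub_nonneg, ← hH]
  refine nonneg_of_nonneg_toFiber σ H (fun hσ x y => ?_) (fun x => ?_) u
  · exact congrArg₂ (· - ·) (F.inner_toFiber_comm hσ _ _) (E.inner_toFiber_comm hσ _ _)
  · rw [hH, sub_nonneg, fiberMap_toFiber, fiberMap_toFiber]
    exact normAt_le_normAt_iff.1 (h x)

end HermitianBundle

end Bundles

/-! ### Pullbacks of kernels and pushouts of cokernels -/

section Squares

variable {C : Type u} [Category.{v} C] [HasZeroMorphisms C]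

/-- A cone over `g` and `f` is killed by `g ≫ h` on its first leg, so that leg factors through `f'`;
the second leg is then forced, `f` being mono. -/
theorem isPullback_of_isLimit_kernelFork {X' Y' X Y Z : C} {f' : X' ⟶ Y'} {g' : X' ⟶ X}
    {g : Y' ⟶ Y} {f : X ⟶ Y} {h : Y ⟶ Z} {w : f ≫ h = 0} {w' : f' ≫ g ≫ h = 0}
    (hf : IsLimit (KernelFork.ofι f w)) (hf' : IsLimit (KernelFork.ofι f' w'))
    (comm : f' ≫ g = g' ≫ f) : IsPullback f' g' g f := by
  have : Mono f := mono_of_isLimit_fork hf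
  have : Mono f' := mono_of_isLimit_fork hf'
  refine ⟨⟨comm⟩, ⟨PullbackCone.IsLimit.mk comm
    (fun s => (KernelFork.IsLimit.lift' hf' s.fst
      (by rw [← Category.assoc, s.condition, Category.assoc, w, comp_zero])).1)
    (fun s => (KernelFork.IsLimit.lift' hf' s.fst _).2) (fun s => ?_) (fun s m hm _ => ?_)⟩⟩
  · rw [← cancel_mono f]
    refine (Category.assoc _ _ _).trans ((congrArg (_ ≫ ·) comm.symm).trans ?_)
    refine (Category.assoc _ _ _).symm.trans (Eq.trans ?_ s.condition)
    exact congrArg (· ≫ g) (KernelFork.IsLimit.lift' hf' s.fst _).2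
  · rw [← cancel_mono f', hm]
    exact (KernelFork.IsLimit.lift' hf' s.fst _).2.symm

theorem isPushout_of_isColimit_cokernelCofork {W X' Y' X Y : C} {k : W ⟶ X'} {f' : X' ⟶ Y'}
    {g' : X' ⟶ X} {g : Y' ⟶ Y} {f : X ⟶ Y} {w : k ≫ g' = 0} {w' : (k ≫ f') ≫ g = 0}
    (hg' : IsColimit (CokernelCofork.ofπ g' w)) (hg : IsColimit (CokernelCofork.ofπ g w'))
    (comm : f' ≫ g = g' ≫ f) : IsPushout f' g' g f := by
  have : Epi g := epi_of_isColimit_cofork hg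
  have : Epi g' := epi_of_isColimit_cofork hg'
  refine ⟨⟨comm⟩, ⟨PushoutCocone.IsColimit.mk comm
    (fun s => (CokernelCofork.IsColimit.desc' hg s.inl
      (by rw [Category.assoc, s.condition, ← Category.assoc, w, zero_comp])).1)
    (fun s => (CokernelCofork.IsColimit.desc' hg s.inl _).2) (fun s => ?_) (fun s m hm _ => ?_)⟩⟩
  · rw [← cancel_epi g']
    refine (Category.assoc _ _ _).symm.trans ((congrArg (· ≫ _) comm.symm).trans ?_)
    refine (Category.assoc _ _ _).trans (Eq.trans ?_ s.condition)
    exact congrArg (f' ≫ ·) (CokernelCofork.IsColimit.desc' hg s.inl _).2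
  · rw [← cancel_epi g, hm]
    exact (CokernelCofork.IsColimit.desc' hg s.inl _).2.symm

end Squares

/-! ### Kernels, cokernels and strict morphisms of bundles -/

noncomputable section Category

section TorsionFreeCoker

variable {R M N : Type*} [CommRing R] [AddCommGroup M] [Module R M] [AddCommGroup N] [Module R N]

/-- The cokernel of a linear map modulo torsion. -/
abbrev TorsionFreeCoker (f : M →ₗ[R] N) : Type _ :=
  (N ⧸ LinearMap.range f) ⧸ Submodule.torsion R (N ⧸ LinearMap.range f)

/-- The projection to the torsion-free cokernel. -/
def torsionFreeCokerMk (f : M →ₗ[R] N) : N →ₗ[R] TorsionFreeCoker f :=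
  (Submodule.mkQ _) ∘ₗ (Submodule.mkQ _)

theorem torsionFreeCokerMk_surjective (f : M →ₗ[R] N) :
    Function.Surjective (torsionFreeCokerMk f) :=
  (Submodule.mkQ_surjective _).comp (Submodule.mkQ_surjective _)

end TorsionFreeCoker

namespace HermitianBundle

open NumberField

variable {K : Type u} [Field K]

section Basic

variable {X Y Z : HermitianBundle.{v} K}

@[simp] theorem comp_toLinearMap (f : X ⟶ Y) (g : Y ⟶ Z) :
    (f ≫ g).toLinearMap = g.toLinearMap ∘ₗ f.toLinearMap := rfl

@[simp] theorem id_toLinearMap : Hom.toLinearMap (𝟙 X) = LinearMap.id := rfl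

@[simp] theorem zero_toLinearMap : Hom.toLinearMap (0 : X ⟶ Y) = 0 := rfl

theorem hom_ext {f g : X ⟶ Y} (h : f.toLinearMap = g.toLinearMap) : f = g := Hom.ext h

theorem toLinearMap_apply_eq_of_comp_eq {f : X ⟶ Y} {g : Y ⟶ Z} {h : X ⟶ Z} (w : f ≫ g = h)
    (x : X.carrier) : g.toLinearMap (f.toLinearMap x) = h.toLinearMap x := by
  subst w; rfl

end Basic

section OrthogonalSection

variable (E : HermitianBundle.{v} K) {M : Type v} [AddCommGroup M] [Module (𝓞 K) M]
variable (p : E.carrier →ₗ[𝓞 K] M) (hp : Function.Surjective p)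

/-- The orthogonal section of a quotient map of Hermitian bundles on a complex fiber. -/
def orthogonalSection (σ : K →+* ℂ) : ComplexFiber σ M →ₗ[ℂ] ComplexFiber σ E.carrier :=
  ((E.form σ).exists_orthogonal_section (fiberMap σ p) (fiberMap_surjective σ hp)).choose

theorem fiberMap_orthogonalSection (σ : K →+* ℂ) (u) :
    fiberMap σ p (E.orthogonalSection p hp σ u) = u :=
  ((E.form σ).exists_orthogonal_section (fiberMap σ p)
    (fiberMap_surjective σ hp)).choose_spec.1 u

theorem inner_orthogonalSection (σ : K →+* ℂ) (u v) (hv : fiberMap σ p v = 0) :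
    (E.form σ).inner v (E.orthogonalSection p hp σ u) = 0 :=
  ((E.form σ).exists_orthogonal_section (fiberMap σ p)
    (fiberMap_surjective σ hp)).choose_spec.2 u v hv

/-- Both sides lift the same vector and are orthogonal to the kernel, so their difference is
orthogonal to itself. -/
theorem fiberConj_orthogonalSection [NumberField K] (σ : K →+* ℂ) (u) :
    fiberConj σ _ (E.orthogonalSection p hp _ u) =
      E.orthogonalSection p hp σ (fiberConj σ _ u) := by
  set t := E.orthogonalSection p hp _ u with ht
  set s := E.orthogonalSection p hp σ (fiberConj σ _ u) with hs
  have hd : fiberMap σ p (fiberConj σ _ t - s) = 0 := by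
    rw [map_sub, fiberMap_fiberConj, ht, hs, fiberMap_orthogonalSection,
      fiberMap_orthogonalSection, sub_self]
  have h₁ : (E.form σ).inner (fiberConj σ _ t - s) (fiberConj σ _ t) = 0 := by
    -- The difference is the conjugate of a kernel vector at the conjugate embedding, where the
    -- orthogonality of `t` is known.
    obtain ⟨w, hw⟩ := (fiberMap_exact σ (LinearMap.exact_subtype_ker_map p) _).1 hd
    obtain ⟨w', rfl⟩ := fiberConj_surjective σ w
    rw [← hw, fiberMap_fiberConj, inner_fiberConj, ← (E.form _).conj_inner_symm,
      E.inner_orthogonalSection p hp _ _ _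
        ((fiberMap_exact _ (LinearMap.exact_subtype_ker_map p) _).2 ⟨_, rfl⟩), map_zero]
  have h₂ := E.inner_orthogonalSection p hp σ (fiberConj σ _ u) _ hd
  rw [← sub_eq_zero]
  refine (E.form σ).definite _ ?_
  have h₃ := InnerProductSpace.Core.inner_sub_right (c := (E.form σ).toCore)
    (fiberConj σ _ t - s) (fiberConj σ _ t) s
  exact h₃.trans ((congrArg₂ (· - ·) h₁ h₂).trans (sub_zero 0))

end OrthogonalSection

variable (K) in
/-- The zero bundle. -/
def zeroBundle : HermitianBundle.{v} K :=
  letI : InnerProductSpace.Core ℂ PUnit.{v + 1} :=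
    { inner := fun _ _ => 0
      conj_inner_symm := fun _ _ => map_zero _
      re_inner_nonneg := fun _ => le_rfl
      add_left := fun _ _ _ => (add_zero 0).symm
      smul_left := fun _ _ _ => (mul_zero _).symm
      definite := fun _ _ => rfl }
  { carrier := PUnit.{v + 1}
    form := fun σ => this.comap 0 fun u v _ => by
      let := complexAlgebra σ
      exact Subsingleton.elim (α := ℂ ⊗[𝓞 K] PUnit.{v + 1}) u v
    form_conjugate := fun _ _ _ => rfl }

variable (K) in
theorem isZero_zeroBundle : IsZero (zeroBundle.{v} K) :=
  (IsZero.iff_id_eq_zero _).2 rfl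

variable [NumberField K]

/-! ### Induced and quotient metrics -/

section Induced

variable (E : HermitianBundle.{v} K) {M : Type v} [AddCommGroup M] [Module (𝓞 K) M]
  [Module.Finite (𝓞 K) M] [Module.Projective (𝓞 K) M]

/-- The Hermitian bundle induced on a module by an injection into a Hermitian bundle. -/
def comap (j : M →ₗ[𝓞 K] E.carrier) (hj : Function.Injective j) : HermitianBundle.{v} K where
  carrier := M
  form σ := (E.form σ).comap (fiberMap σ j) (fiberMap_injective σ hj)
  form_conjugate σ x y := E.form_conjugate σ (j x) (j y)

/-- The inclusion of an induced Hermitian bundle. -/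
def comapι (j : M →ₗ[𝓞 K] E.carrier) (hj : Function.Injective j) : E.comap j hj ⟶ E :=
  ⟨j, fun _ _ => le_rfl⟩

variable (p : E.carrier →ₗ[𝓞 K] M) (hp : Function.Surjective p)

/-- The Hermitian bundle with the quotient norms on a quotient of a Hermitian bundle. -/
def map : HermitianBundle.{v} K where
  carrier := M
  form σ := (E.form σ).comap (E.orthogonalSection p hp σ)
    (Function.LeftInverse.injective (E.fiberMap_orthogonalSection p hp σ))
  form_conjugate σ x y := by
    change (E.form _).inner _ _ = (E.form _).inner _ _
    rw [← inner_fiberConj, fiberConj_orthogonalSection, fiberConj_orthogonalSection,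
      fiberConj_toFiber, fiberConj_toFiber]

theorem normSqAt_map (σ : K →+* ℂ) (u : ComplexFiber σ M) :
    (E.map p hp).normSqAt σ u = E.normSqAt σ (E.orthogonalSection p hp σ u) := rfl

/-- Pythagoras for `v = (v - s) + s`, where `s` is the orthogonal lift of the image of `v`. -/
theorem normSqAt_map_le (σ : K →+* ℂ) (v : ComplexFiber σ E.carrier) :
    (E.map p hp).normSqAt σ (fiberMap σ p v) ≤ E.normSqAt σ v := by
  rw [normSqAt_map]
  set s := E.orthogonalSection p hp σ (fiberMap σ p v) with hs
  have hd : fiberMap σ p (v - s) = 0 := by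
    rw [map_sub, hs, fiberMap_orthogonalSection, sub_self]
  have h₁ := E.inner_orthogonalSection p hp σ (fiberMap σ p v) _ hd
  have h₂ : (E.form σ).inner s (v - s) = 0 := by
    rw [← (E.form σ).conj_inner_symm, h₁, map_zero]
  have h₃ := InnerProductSpace.Core.inner_add_add_self (c := (E.form σ).toCore) (v - s) s
  rw [sub_add_cancel] at h₃
  have h₄ : (E.form σ).inner v v = (E.form σ).inner (v - s) (v - s) + (E.form σ).inner s s := by
    refine h₃.trans ?_
    change (E.form σ).inner _ _ + (E.form σ).inner _ _ + (E.form σ).inner _ _ +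
      (E.form σ).inner _ _ = _
    rw [h₁, h₂, add_zero, add_zero]
  unfold normSqAt
  rw [h₄, Complex.add_re]
  exact le_add_of_nonneg_left (E.normSqAt_nonneg σ _)

/-- The projection to a quotient Hermitian bundle. -/
def mapπ : E ⟶ E.map p hp :=
  ⟨p, fun σ x => normAt_le_normAt_iff.2 (E.normSqAt_map_le p hp σ (toFiber σ x))⟩

end Induced

/-! ### Recognition of kernels and cokernels -/

variable {X Y Z : HermitianBundle.{v} K}

theorem normSqAt_fiberMap_le_normSqAt (f : X ⟶ Y) (σ : K →+* ℂ) (u) :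
    Y.normSqAt σ (fiberMap σ f.toLinearMap u) ≤ X.normSqAt σ u := by
  simpa using normSqAt_fiberMap_le f.toLinearMap (LinearMap.id (M := X.carrier)) σ
    (f.normAt_le σ) u

/-- `f` is a kernel of `g` if it is injective and isometric with image `ker g`. -/
def isLimitKernelFork {f : X ⟶ Y} {g : Y ⟶ Z} (w : f ≫ g = 0)
    (hf : Function.Injective f.toLinearMap)
    (hn : ∀ σ x, X.normAt σ x ≤ Y.normAt σ (f.toLinearMap x))
    (hk : ∀ y, g.toLinearMap y = 0 → y ∈ LinearMap.range f.toLinearMap) :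
    IsLimit (KernelFork.ofι f w) :=
  have key {T : HermitianBundle.{v} K} (t : T ⟶ Y) (ht : t ≫ g = 0) (x : T.carrier) :
      f.toLinearMap (((LinearEquiv.ofInjective f.toLinearMap hf).symm : _ →ₗ[𝓞 K] _)
        (t.toLinearMap.codRestrict _
          (fun x => hk _ (toLinearMap_apply_eq_of_comp_eq ht x)) x)) = t.toLinearMap x :=
    congrArg Subtype.val ((LinearEquiv.ofInjective f.toLinearMap hf).apply_symm_apply _)
  KernelFork.IsLimit.ofι f w
    (fun t ht => ⟨((LinearEquiv.ofInjective f.toLinearMap hf).symm : _ →ₗ[𝓞 K] _) ∘ₗ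
        t.toLinearMap.codRestrict _ (fun x => hk _ (toLinearMap_apply_eq_of_comp_eq ht x)),
      fun σ x => (hn σ _).trans ((congrArg (Y.normAt σ) (key t ht x)).trans_le
        (t.normAt_le σ x))⟩)
    (fun t ht => hom_ext (LinearMap.ext (key t ht)))
    (fun t ht _ hm => hom_ext (LinearMap.ext fun x => hf
      ((toLinearMap_apply_eq_of_comp_eq hm x).trans (key t ht x).symm)))

/-- `g` is a cokernel of `f` if it is surjective, carries the quotient norms, and has the saturation
of `im f` as its kernel. -/
def isColimitCokernelCofork {f : X ⟶ Y} {g : Y ⟶ Z} (w : f ≫ g = 0)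
    (hg : Function.Surjective g.toLinearMap)
    (hn : ∀ σ u, ∃ v, fiberMap σ g.toLinearMap v = u ∧ Y.normSqAt σ v ≤ Z.normSqAt σ u)
    (hk : ∀ y, g.toLinearMap y = 0 → ∃ a : 𝓞 K, a ≠ 0 ∧ ∃ x, f.toLinearMap x = a • y) :
    IsColimit (CokernelCofork.ofπ g w) :=
  have hle {T : HermitianBundle.{v} K} (t : Y ⟶ T) (ht : f ≫ t = 0) :
      LinearMap.ker g.toLinearMap ≤ LinearMap.ker t.toLinearMap := fun y hy => by
    -- The target is torsion-free, so a map that kills `im f` kills its saturation.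
    obtain ⟨a, ha, x, hx⟩ := hk y hy
    have h := toLinearMap_apply_eq_of_comp_eq ht x
    rw [hx, map_smul] at h
    exact (smul_eq_zero.1 h).resolve_left ha
  have key {T : HermitianBundle.{v} K} (t : Y ⟶ T) (ht : f ≫ t = 0) :
      (((LinearMap.ker g.toLinearMap).liftQ t.toLinearMap (hle t ht)) ∘ₗ
        ((g.toLinearMap.quotKerEquivOfSurjective hg).symm : _ →ₗ[𝓞 K] _)) ∘ₗ g.toLinearMap =
          t.toLinearMap := by
    ext y
    have h : (g.toLinearMap.quotKerEquivOfSurjective hg).symm (g.toLinearMap y) =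
        Submodule.Quotient.mk y := by
      rw [LinearEquiv.symm_apply_eq]; rfl
    simp [h]
  CokernelCofork.IsColimit.ofπ g w
    (fun t ht => ⟨((LinearMap.ker g.toLinearMap).liftQ t.toLinearMap (hle t ht)) ∘ₗ
        ((g.toLinearMap.quotKerEquivOfSurjective hg).symm : _ →ₗ[𝓞 K] _),
      fun σ z => normAt_le_normAt_iff.2 (by
        -- The lift `v` need not come from `Y` itself, so contraction of `t` is needed on the whole
        -- fiber.
        obtain ⟨v, hv, hvn⟩ := hn σ (toFiber σ z)
        rw [← fiberMap_toFiber, ← hv, ← fiberMap_comp, key t ht, hv]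
        exact (normSqAt_fiberMap_le_normSqAt t σ v).trans hvn)⟩)
    (fun t ht => hom_ext (key t ht))
    (fun t ht m hm => hom_ext (LinearMap.ext fun z => by
      obtain ⟨y, rfl⟩ := hg z
      exact (toLinearMap_apply_eq_of_comp_eq hm y).trans (LinearMap.congr_fun (key t ht) y).symm))

section Kernel

instance (f : X ⟶ Y) : Module.Projective (𝓞 K) (LinearMap.ker f.toLinearMap) :=
  Module.Projective.of_finite_of_isTorsionFree

/-- The kernel of a morphism, with the induced norms. -/
def kernelBundle (f : X ⟶ Y) : HermitianBundle.{v} K :=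
  X.comap (LinearMap.ker f.toLinearMap).subtype (Submodule.subtype_injective _)

/-- The inclusion of the kernel. -/
def kernelBundleι (f : X ⟶ Y) : kernelBundle f ⟶ X := X.comapι _ _

theorem kernelBundleι_comp (f : X ⟶ Y) : kernelBundleι f ≫ f = 0 :=
  hom_ext (LinearMap.ext fun x => x.2)

theorem normSqAt_kernelBundleι (f : X ⟶ Y) (σ : K →+* ℂ) (u) :
    X.normSqAt σ (fiberMap σ (kernelBundleι f).toLinearMap u) = (kernelBundle f).normSqAt σ u :=
  rfl

theorem normAt_kernelBundleι (f : X ⟶ Y) (σ : K →+* ℂ) (u) :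
    X.normAt σ ((kernelBundleι f).toLinearMap u) = (kernelBundle f).normAt σ u :=
  rfl

theorem kernelBundleι_injective (f : X ⟶ Y) :
    Function.Injective (kernelBundleι f).toLinearMap := Submodule.subtype_injective _

theorem mem_range_kernelBundleι (f : X ⟶ Y) {x : X.carrier} (hx : f.toLinearMap x = 0) :
    x ∈ LinearMap.range (kernelBundleι f).toLinearMap := ⟨⟨x, hx⟩, rfl⟩

/-- The inclusion of the kernel is a kernel. -/
def kernelBundleIsLimit (f : X ⟶ Y) :
    IsLimit (KernelFork.ofι (kernelBundleι f) (kernelBundleι_comp f)) :=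
  isLimitKernelFork _ (kernelBundleι_injective f)
    (fun _ _ => le_rfl) (fun _ => mem_range_kernelBundleι f)

end Kernel

section Cokernel

instance (f : X ⟶ Y) : Module.Projective (𝓞 K) (TorsionFreeCoker f.toLinearMap) :=
  Module.Projective.of_finite_of_isTorsionFree

/-- The cokernel of a morphism, with the quotient norms. -/
def cokernelBundle (f : X ⟶ Y) : HermitianBundle.{v} K :=
  Y.map (torsionFreeCokerMk f.toLinearMap) (torsionFreeCokerMk_surjective _)

/-- The projection to the cokernel. -/
def cokernelBundleπ (f : X ⟶ Y) : Y ⟶ cokernelBundle f := Y.mapπ _ _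

theorem comp_cokernelBundleπ (f : X ⟶ Y) : f ≫ cokernelBundleπ f = 0 :=
  hom_ext (LinearMap.ext fun x => by
    change Submodule.mkQ _ (Submodule.mkQ _ (f.toLinearMap x)) = 0
    rw [Submodule.mkQ_apply (LinearMap.range _), (Submodule.Quotient.mk_eq_zero _).2
      (LinearMap.mem_range_self _ x), map_zero])

theorem cokernelBundleπ_surjective (f : X ⟶ Y) :
    Function.Surjective (cokernelBundleπ f).toLinearMap := torsionFreeCokerMk_surjective _

theorem exists_smul_of_cokernelBundleπ_eq_zero (f : X ⟶ Y) (y : Y.carrier)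
    (hy : (cokernelBundleπ f).toLinearMap y = 0) :
    ∃ a : 𝓞 K, a ≠ 0 ∧ ∃ x, f.toLinearMap x = a • y := by
  obtain ⟨a, ha⟩ := (Submodule.mem_torsion_iff _).1 ((Submodule.Quotient.mk_eq_zero _).1 hy)
  exact ⟨a, nonZeroDivisors.coe_ne_zero a, (Submodule.Quotient.mk_eq_zero _).1 ha⟩

theorem exists_cokernelBundleπ_lift (f : X ⟶ Y) (σ : K →+* ℂ) (u) :
    ∃ v, fiberMap σ (cokernelBundleπ f).toLinearMap v = u ∧
      Y.normSqAt σ v ≤ (cokernelBundle f).normSqAt σ u :=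
  ⟨_, Y.fiberMap_orthogonalSection _ _ σ u, le_rfl⟩

/-- The projection to the cokernel is a cokernel. -/
def cokernelBundleIsColimit (f : X ⟶ Y) :
    IsColimit (CokernelCofork.ofπ (cokernelBundleπ f) (comp_cokernelBundleπ f)) :=
  isColimitCokernelCofork _ (cokernelBundleπ_surjective f) (exists_cokernelBundleπ_lift f)
    (exists_smul_of_cokernelBundleπ_eq_zero f)

end Cokernel

/-- A strict mono is isomorphic to an explicit kernel by maps contracting in both directions, hence
isometric; its image is saturated since `Z` is torsion-free. Conversely, the cokernel projection has
the saturation of the image as its kernel. -/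
theorem strictMono_iff {f : X ⟶ Y} : strictMono (HermitianBundle.{v} K) f ↔
    Function.Injective f.toLinearMap ∧ (∀ σ x, X.normAt σ x ≤ Y.normAt σ (f.toLinearMap x)) ∧
      ∀ (a : 𝓞 K) (y : Y.carrier), a ≠ 0 → a • y ∈ LinearMap.range f.toLinearMap →
        y ∈ LinearMap.range f.toLinearMap := by
  constructor
  · rintro ⟨Z, g, w, ⟨hf⟩, -⟩
    obtain ⟨l, hl⟩ := KernelFork.IsLimit.lift' hf _ (kernelBundleι_comp g)
    obtain ⟨m, hm⟩ := KernelFork.IsLimit.lift' (kernelBundleIsLimit g) _ w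
    change l ≫ f = kernelBundleι g at hl
    change m ≫ kernelBundleι g = f at hm
    have : Mono f := mono_of_isLimit_fork hf
    have hml : m ≫ l = 𝟙 X := by
      rw [← cancel_mono f, Category.assoc, hl, hm, Category.id_comp]
    have hx (x : X.carrier) : l.toLinearMap (m.toLinearMap x) = x :=
      toLinearMap_apply_eq_of_comp_eq hml x
    refine ⟨?_, fun σ x => ?_, fun a y ha ⟨x, hy⟩ => ?_⟩
    · rw [← hm]
      exact (kernelBundleι_injective g).comp (Function.LeftInverse.injective hx)
    · calc X.normAt σ x = X.normAt σ (l.toLinearMap (m.toLinearMap x)) := by rw [hx]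
        _ ≤ (kernelBundle g).normAt σ (m.toLinearMap x) := l.normAt_le σ _
        _ = Y.normAt σ (f.toLinearMap x) := by
          rw [← normAt_kernelBundleι, toLinearMap_apply_eq_of_comp_eq hm]
    · have h := toLinearMap_apply_eq_of_comp_eq w x
      rw [hy, map_smul] at h
      obtain ⟨z, rfl⟩ := mem_range_kernelBundleι g ((smul_eq_zero.1 h).resolve_left ha)
      exact ⟨l.toLinearMap z, toLinearMap_apply_eq_of_comp_eq hl z⟩
  · rintro ⟨hf, hn, hs⟩
    refine ⟨_, cokernelBundleπ f, comp_cokernelBundleπ f,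
      ⟨isLimitKernelFork _ hf hn fun y hy => ?_⟩, ⟨cokernelBundleIsColimit f⟩⟩
    obtain ⟨a, ha, hx⟩ := exists_smul_of_cokernelBundleπ_eq_zero f y hy
    exact hs a y ha hx

/-- The comparison is with the explicit cokernel, where orthogonal lifts attain the quotient norm.
Conversely, such a map is the cokernel of its kernel. -/
theorem strictEpi_iff {g : Y ⟶ Z} : strictEpi (HermitianBundle.{v} K) g ↔
    Function.Surjective g.toLinearMap ∧
      ∀ σ u, ∃ v, fiberMap σ g.toLinearMap v = u ∧ Y.normSqAt σ v ≤ Z.normSqAt σ u := by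
  constructor
  · rintro ⟨X, f, w, -, ⟨hg⟩⟩
    obtain ⟨e, he⟩ := CokernelCofork.IsColimit.desc' hg _ (comp_cokernelBundleπ f)
    obtain ⟨d, hd⟩ := CokernelCofork.IsColimit.desc' (cokernelBundleIsColimit f) _ w
    change g ≫ e = cokernelBundleπ f at he
    change cokernelBundleπ f ≫ d = g at hd
    have : Epi g := epi_of_isColimit_cofork hg
    have hed : e ≫ d = 𝟙 Z := by
      rw [← cancel_epi g, ← Category.assoc, he, hd, Category.comp_id]
    refine ⟨fun z => ?_, fun σ u => ?_⟩
    · obtain ⟨y, hy⟩ := cokernelBundleπ_surjective f (e.toLinearMap z)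
      refine ⟨y, ?_⟩
      rw [← toLinearMap_apply_eq_of_comp_eq hd, hy, toLinearMap_apply_eq_of_comp_eq hed]
      rfl
    · obtain ⟨v, hv, hvn⟩ := exists_cokernelBundleπ_lift f σ (fiberMap σ e.toLinearMap u)
      refine ⟨v, ?_, hvn.trans (normSqAt_fiberMap_le_normSqAt e σ u)⟩
      rw [← hd, comp_toLinearMap, fiberMap_comp, hv, ← fiberMap_comp, ← comp_toLinearMap, hed,
        id_toLinearMap, fiberMap_id]
  · rintro ⟨hg, hn⟩
    refine ⟨_, kernelBundleι g, kernelBundleι_comp g, ⟨kernelBundleIsLimit g⟩,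
      ⟨isColimitCokernelCofork _ hg hn fun y hy => ?_⟩⟩
    obtain ⟨x, hx⟩ := mem_range_kernelBundleι g hy
    exact ⟨1, one_ne_zero, x, by rw [hx, one_smul]⟩

-- With `f` a kernel of `h`, the pullback is the kernel of `g ≫ h`. A short lift along `g` of the
-- image of `u` under `f` lies in that kernel, and `f` is contracting, so it is a short lift of `u`.
variable (K) in
theorem strictEpi_closedUnderPullbacksAlong_strictMono :
    ClosedUnderPullbacksAlong (strictEpi (HermitianBundle.{v} K)) (strictMono _) := by
  rintro X Y Y' g f hg hf
  obtain ⟨hgs, hgn⟩ := strictEpi_iff.1 hg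
  obtain ⟨hfi, -, -⟩ := strictMono_iff.1 hf
  obtain ⟨Z, h, w, ⟨hk⟩, -⟩ := hf
  have w' : kernelBundleι (g ≫ h) ≫ g ≫ h = 0 := kernelBundleι_comp _
  obtain ⟨g', hg'⟩ := KernelFork.IsLimit.lift' hk (kernelBundleι (g ≫ h) ≫ g)
    (by rw [Category.assoc, w'])
  change g' ≫ f = _ at hg'
  have hfg (x) : f.toLinearMap (g'.toLinearMap x) =
      g.toLinearMap ((kernelBundleι (g ≫ h)).toLinearMap x) :=
    toLinearMap_apply_eq_of_comp_eq hg' x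
  refine ⟨_, kernelBundleι (g ≫ h), g',
    isPullback_of_isLimit_kernelFork hk (kernelBundleIsLimit (g ≫ h)) hg'.symm,
    strictEpi_iff.2 ⟨fun x => ?_, fun σ u => ?_⟩⟩
  · obtain ⟨y, hy⟩ := hgs (f.toLinearMap x)
    obtain ⟨x', rfl⟩ := mem_range_kernelBundleι (g ≫ h) (x := y) (by
      rw [comp_toLinearMap, LinearMap.comp_apply, hy, toLinearMap_apply_eq_of_comp_eq w]; rfl)
    exact ⟨x', hfi ((hfg x').trans hy)⟩
  · obtain ⟨v, hv, hvn⟩ := hgn σ (fiberMap σ f.toLinearMap u)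
    obtain ⟨v', rfl⟩ := exists_fiberMap_eq σ
      (f := (kernelBundleι (g ≫ h)).toLinearMap) (g := (g ≫ h).toLinearMap)
      (fun y hy => ⟨1, one_ne_zero, by
        rw [one_smul]; exact mem_range_kernelBundleι (g ≫ h) hy⟩) v (by
      rw [comp_toLinearMap, fiberMap_comp, hv, ← fiberMap_comp, ← comp_toLinearMap, w,
        zero_toLinearMap, fiberMap_zero])
    refine ⟨v', fiberMap_injective σ hfi ?_, ?_⟩
    · rw [← hv, ← fiberMap_comp, ← fiberMap_comp, ← comp_toLinearMap, ← comp_toLinearMap, hg']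
    · rw [normSqAt_kernelBundleι] at hvn
      exact hvn.trans (normSqAt_fiberMap_le_normSqAt f σ u)

-- With `g'` a cokernel of `k`, the pushout is the cokernel of `k ≫ f'`. A short lift `v` of the
-- image of `u` under `f` comes by the isometry `f'` from some `t` over `u`, which bounds the norm
-- of `u` by that of `v`.
variable (K) in
theorem strictMono_closedUnderPushoutsAlong_strictEpi :
    ClosedUnderPushoutsAlong (strictMono (HermitianBundle.{v} K)) (strictEpi _) := by
  rintro X' Y' X f' g' hf' hg'
  obtain ⟨hgs, hgn⟩ := strictEpi_iff.1 hg'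
  obtain ⟨hfi, hfn, hfs⟩ := strictMono_iff.1 hf'
  obtain ⟨W, k, w, -, ⟨hk⟩⟩ := hg'
  have w' : (k ≫ f') ≫ cokernelBundleπ (k ≫ f') = 0 := comp_cokernelBundleπ _
  set g := cokernelBundleπ (k ≫ f') with hg
  obtain ⟨f, hf⟩ := CokernelCofork.IsColimit.desc' hk (f' ≫ g) (by rw [← Category.assoc, w'])
  change g' ≫ f = _ at hf
  have hfg (x) : f.toLinearMap (g'.toLinearMap x) = g.toLinearMap (f'.toLinearMap x) :=
    toLinearMap_apply_eq_of_comp_eq hf x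
  have hgk (y) (hy : g.toLinearMap y = 0) :
      ∃ a : 𝓞 K, a ≠ 0 ∧ ∃ x, f'.toLinearMap (k.toLinearMap x) = a • y :=
    exists_smul_of_cokernelBundleπ_eq_zero (k ≫ f') y hy
  have hinj : Function.Injective f.toLinearMap := by
    rw [injective_iff_map_eq_zero]
    intro x hx
    obtain ⟨x', rfl⟩ := hgs x
    rw [hfg] at hx
    obtain ⟨a, ha, z, hz⟩ := hgk _ hx
    -- Injectivity of `f'` gives `k z = a • x'`; applying `g'` yields `a • g' x' = 0`.
    rw [← map_smul] at hz
    have h := toLinearMap_apply_eq_of_comp_eq w z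
    rw [hfi hz, map_smul] at h
    exact (smul_eq_zero.1 h).resolve_left ha
  refine ⟨_, g, f, isPushout_of_isColimit_cokernelCofork hk (cokernelBundleIsColimit (k ≫ f'))
    hf.symm, strictMono_iff.2 ⟨hinj, fun σ x => ?_, ?_⟩⟩
  · rw [normAt_le_normAt_iff, ← fiberMap_toFiber]
    generalize toFiber σ x = u
    obtain ⟨v, hv, hvn⟩ := exists_cokernelBundleπ_lift (k ≫ f') σ (fiberMap σ f.toLinearMap u)
    rw [← hg] at hv
    obtain ⟨u', rfl⟩ := fiberMap_surjective σ hgs u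
    have hfgσ (z) : fiberMap σ f.toLinearMap (fiberMap σ g'.toLinearMap z) =
        fiberMap σ g.toLinearMap (fiberMap σ f'.toLinearMap z) := by
      rw [← fiberMap_comp, ← fiberMap_comp, ← comp_toLinearMap, ← comp_toLinearMap, hf]
    obtain ⟨z, hz⟩ := exists_fiberMap_eq σ (f := (k ≫ f').toLinearMap) (g := g.toLinearMap)
      hgk (v - fiberMap σ f'.toLinearMap u') (by rw [map_sub, hv, hfgσ, sub_self])
    rw [comp_toLinearMap, fiberMap_comp, eq_sub_iff_add_eq, ← map_add] at hz
    -- By `hz`, `f'` sends `t` to `v`; injectivity of `f` on the fiber shows that `t` and `u'` have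
    -- the same image under `g'`.
    set t := fiberMap σ k.toLinearMap z + u' with ht
    have htu : fiberMap σ g'.toLinearMap t = fiberMap σ g'.toLinearMap u' := by
      refine fiberMap_injective σ hinj ?_
      rw [hfgσ, hz, hv]
    rw [← htu] at hvn ⊢
    refine (normSqAt_fiberMap_le_normSqAt g' σ t).trans (le_trans ?_ hvn)
    rw [← hz]
    simpa using normSqAt_fiberMap_le (LinearMap.id (M := X'.carrier)) f'.toLinearMap σ
      (hfn σ) t
  · rintro a y ha ⟨x, hx⟩
    obtain ⟨y', rfl⟩ := cokernelBundleπ_surjective (k ≫ f') y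
    obtain ⟨x', rfl⟩ := hgs x
    rw [hfg] at hx
    -- The difference is only in the saturation of the image of `k ≫ f'`; the factor `b` moves it
    -- into the image, so `(b * a) • y'` lies in the saturated image of `f'`.
    obtain ⟨b, hb, z, hz⟩ := hgk (a • y' - f'.toLinearMap x') (by
      rw [map_sub, map_smul, hx]; exact sub_self _)
    obtain ⟨t, rfl⟩ := hfs (b * a) y' (mul_ne_zero hb ha) ⟨k.toLinearMap z + b • x', by
      rw [map_add, hz, map_smul, smul_sub, mul_smul, sub_add_cancel]⟩
    exact ⟨g'.toLinearMap t, hfg t⟩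

end HermitianBundle

end Category

theorem mainTheorem5 (K : Type u) [Field K] [NumberField K] :
    IsParabelian (HermitianBundle.{v} K) where
  hasZeroObject := ⟨_, HermitianBundle.isZero_zeroBundle K⟩
  hasKernels := ⟨fun f => ⟨_, HermitianBundle.kernelBundleIsLimit f⟩⟩
  hasCokernels := ⟨fun f => ⟨_, HermitianBundle.cokernelBundleIsColimit f⟩⟩
  strictEpi_pullback := HermitianBundle.strictEpi_closedUnderPullbacksAlong_strictMono K
  strictMono_pushout := HermitianBundle.strictMono_closedUnderPushoutsAlong_strictEpi K
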